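/- Let $A$ be a totally ordered finite alphabet. A word $w\in A^*$ is primitive if $w=z^n$ with $z\in A^*$, $n\ge 0$ implies $n=1$ (so the empty word is not primitive); two words $u,v$ are conjugate if $u=xy$ and $v=yx$ for some $x,y\in A^*$. Words are compared in lexicographic order (a proper prefix being smaller). A Lyndon word is a primitive word that is the smallest of its conjugates. A primitive word $w$ of length $n$ with conjugates $v_1<\dots<v_n$ is called perfectly clustering if its Burrows–Wheeler transform, the word formed by the last letters of $v_1,\dots,v_n$ in this order, is $b_r^{|w|_{b_r}}\cdots b_2^{|w|_{b_2}}b_1^{|w|_{b_1}}$, where $A=\{b_1<\dots<b_r\}$ and $|w|_b$ is the number of occurrences of $b$ in $w$ (that is, if its Burrows–Wheeler transform is weakly decreasing). A special factorization of $w$ is a factorization $$w=a_1\pi_1a_2\pi_2\cdots\pi_{k-1}a_k,$$ where $a_1<a_2<\dots<a_k$ are exactly the letters occurring in $w$ and $\pi_1,\dots,\pi_{k-1}\in A^*$; one then sets $W=a_k\pi_{k-1}\cdots\pi_2a_2\pi_1a_1$. It is palindromic if every $\pi_i$ is a palindrome. The empty word is a palindrome. **Theorem.** For a primitive word $w$ on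 $A$, the following conditions are equivalent: (i) $w$ is a perfectly clustering Lyndon word; (ii) $w$ is a product of two (possibly empty) palindromes and $w$ has a palindromic special factorization; (iii) $w$ has a special factorization such that $w$ is conjugate to the corresponding word $W$. -/

import Mathlib

/- A word on the alphabet `A` is a `List A`; concatenation is `++`.  Two words are conjugate iff
they are rotations of each other (`List.IsRotated`, notation `~r`); `w.cyclicPermutations` lists
the conjugates of `w`.  The order on `List A` is the lexicographic one. -/

namespace ClusteringWords

/-- `w` is primitive: whenever `w = z ^ n` for a word `z`, one has `n = 1`.
In particular the empty word is not primitive. -/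
def IsPrimitive {A : Type*} (w : List A) : Prop :=
  ∀ (z : List A) (n : ℕ), w = (List.replicate n z).flatten → n = 1

/-- A Lyndon word is a primitive word that is minimal, for the lexicographic order, among
its conjugates. -/
def IsLyndon {A : Type*} [LinearOrder A] (w : List A) : Prop :=
  IsPrimitive w ∧ ∀ v : List A, w ~r v → w ≤ v

/-- The rows of the Burrows-Wheeler matrix: the conjugates of `w`, in increasing
lexicographic order. -/
def bwRows {A : Type*} [LinearOrder A] (w : List A) : List (List A) :=
  w.cyclicPermutations.toFinset.sort (· ≤ ·)

/-- The Burrows-Wheeler transform: the word formed by the last letters of the rows. -/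
def bw {A : Type*} [LinearOrder A] (w : List A) : List A :=
  (bwRows w).filterMap List.getLast?

/-- The `i`-th letter of the finite totally ordered alphabet `A`. -/
def letter (A : Type*) [LinearOrder A] [Fintype A] (i : Fin (Fintype.card A)) : A :=
  (Finset.univ : Finset A).orderEmbOfFin rfl i

/-- For a permutation `σ` of the indices of the letters of `A`, the word `w` is `σ`-clustering
if it is primitive and its Burrows-Wheeler transform is the product of the
`a_{σ(i)} ^ |w|_{a_{σ(i)}}`, taken for increasing `i`. -/
def IsClustering {A : Type*} [LinearOrder A] [Fintype A]
    (σ : Equiv.Perm (Fin (Fintype.card A))) (w : List A) : Prop :=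
  IsPrimitive w ∧
    bw w = (List.finRange (Fintype.card A)).flatMap
      (fun i => List.replicate (w.count (letter A (σ i))) (letter A (σ i)))

/-- Perfectly clustering: clustering for the order-reversing permutation of the letters. -/
def IsPerfectlyClustering {A : Type*} [LinearOrder A] [Fintype A] (w : List A) : Prop :=
  IsClustering Fin.revPerm w

/-- The word `w` is the product of two (possibly empty) palindromes. -/
def IsProductOfTwoPalindromes {A : Type*} (w : List A) : Prop :=
  ∃ p q : List A, p.Palindrome ∧ q.Palindrome ∧ w = p ++ q

/-- The letters `a_1 < ⋯ < a_k` occurring in `w`, in increasing order. -/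
def letters {A : Type*} [LinearOrder A] (w : List A) : List A :=
  w.toFinset.sort (· ≤ ·)

/-- `interleave [b_1, …, b_k] [π_1, …, π_{k-1}]` is the word `b_1 π_1 b_2 π_2 ⋯ π_{k-1} b_k`. -/
def interleave {A : Type*} : List A → List (List A) → List A
  | [], _ => []
  | a :: _, [] => [a]
  | a :: l, p :: ps => a :: (p ++ interleave l ps)

/-- The words `π = [π_1, …, π_{k-1}]` define a special factorization
`w = a_1 π_1 a_2 π_2 ⋯ π_{k-1} a_k`, where `a_1 < ⋯ < a_k` are the letters occurring in `w`. -/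
def IsSpecialFactorization {A : Type*} [LinearOrder A] (w : List A) (π : List (List A)) : Prop :=
  π.length + 1 = (letters w).length ∧ w = interleave (letters w) π

/-- The word `W = a_k π_{k-1} ⋯ π_2 a_2 π_1 a_1` attached to a special factorization of `w`. -/
def specialReverse {A : Type*} [LinearOrder A] (w : List A) (π : List (List A)) : List A :=
  interleave (letters w).reverse π.reverse

/-- A special factorization all of whose `π_i` are palindromes. -/
def IsPalindromicSpecialFactorization {A : Type*} [LinearOrder A]
    (w : List A) (π : List (List A)) : Prop :=
  IsSpecialFactorization w π ∧ ∀ p ∈ π, p.Palindrome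

end ClusteringWords

/-!
All three conditions say that `w` is read along the orbit of the smallest point of a discrete
symmetric interval exchange `T` on `{0, …, n}` which consists of a single cycle (the structure
`SymmetricExchange`): the points are coloured by letters in increasing order, `T` increases on each
colour class, and it puts the images of the classes in decreasing order.

If `w` is a perfectly clustering Lyndon word, the points are the rows of its Burrows–Wheeler
matrix and `T` rotates a row by one letter.  Conversely the words read from the points of an
exchange are increasing in the point, so they are the rows of the matrix, whose last letters
decrease by construction.

For such a word, `T = rev ∘ flip`, where `rev` reverses all points and `flip` reverses each colour
class.  Conjugation by `flip` inverts `T` and preserves letters, which makes `w` a product of two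
palindromes.  For the special factorization, cut the orbit of `0` at the smallest points of the
classes, the left ends.  The permutation `loop`, which follows `T` but closes up the orbit at left
ends, is again a product of two involutions, `innerFlip` and `outerFlip`, of which the first fixes
the left ends and preserves letters.  Each cycle of a product of two involutions contains at most
two of their fixed points (`card_fixedPairs_sameCycle_le_two`).  Counting the fixed points of all
four involutions then shows that each cycle of `loop` contains exactly one left end
(`eq_of_sameCycle_loop`).  Hence the orbit of a left end next meets the left end of the following
class, and `innerFlip` shows that the letters in between form a palindrome
(`exists_first_return`).

A product of two palindromes is conjugate to its reversal, and the reversal of `w` is `W` if all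
factors are palindromes.  Finally, suppose that `w` is conjugate to `W`.  Matching the letters of
`w` and `W` through the factorization, and then through the conjugation, gives a permutation `D` of
the positions that commutes with the shift off the distinguished positions, and along which the
letters decrease (`exists_reflection`).  Numbering the positions by the powers of `D⁻¹` gives the
exchange (`exists_exchange_of_commute_off`); the point is that `D` has a single cycle, because the
complement of the cycle of the first position is invariant under the shift.
-/

namespace ClusteringWords

/-! ### Conjugates in lexicographic order -/

theorem cons_le_cons_iff_lt_or {A : Type*} [LinearOrder A] {a b : A} {u v : List A} :
    a :: u ≤ b :: v ↔ a < b ∨ a = b ∧ u ≤ v := by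
  rw [le_iff_lt_or_eq, le_iff_lt_or_eq, List.cons_lt_cons_iff, List.cons.injEq]
  tauto

theorem append_lt_append_of_lt {A : Type*} [LinearOrder A] (s t : List A) :
    ∀ u v : List A, u.length = v.length → u < v → u ++ s < v ++ t
  | [], [], _, h => absurd h (lt_irrefl _)
  | a :: u, b :: v, hl, h => by
    rw [List.cons_lt_cons_iff] at h
    rw [List.cons_append, List.cons_append, List.cons_lt_cons_iff]
    rcases h with h | ⟨h, h'⟩
    · exact Or.inl h
    · exact Or.inr ⟨h, append_lt_append_of_lt s t u v (by simpa using hl) h'⟩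

theorem mem_bwRows {A : Type*} [LinearOrder A] (w v : List A) : v ∈ bwRows w ↔ w ~r v := by
  rw [bwRows, Finset.mem_sort, List.mem_toFinset, List.mem_cyclicPermutations_iff,
    List.isRotated_comm]

theorem pairwise_bwRows {A : Type*} [LinearOrder A] (w : List A) :
    (bwRows w).Pairwise (· < ·) :=
  (Finset.sortedLT_sort _).pairwise

/-! ### Weakly decreasing rearrangements -/

theorem letter_bijective (A : Type*) [LinearOrder A] [Fintype A] :
    Function.Bijective (letter A) := by
  rw [Fintype.bijective_iff_injective_and_card]
  exact ⟨((Finset.univ : Finset A).orderEmbOfFin rfl).injective, by simp⟩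

theorem letter_strictMono (A : Type*) [LinearOrder A] [Fintype A] : StrictMono (letter A) :=
  ((Finset.univ : Finset A).orderEmbOfFin rfl).strictMono

theorem flatMap_replicate_perm {A : Type*} [LinearOrder A] [Fintype A]
    (σ : Equiv.Perm (Fin (Fintype.card A))) (w : List A) :
    ((List.finRange (Fintype.card A)).flatMap
      (fun i => List.replicate (w.count (letter A (σ i))) (letter A (σ i)))).Perm w := by
  rw [List.perm_iff_count]
  intro b
  obtain ⟨j, rfl⟩ := (letter_bijective A).2 b
  rw [List.count_flatMap, ← Fin.sum_univ_def, Finset.sum_eq_single (σ.symm j)]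
  · simp
  · intro i _ hi
    have : letter A (σ i) ≠ letter A j := by
      intro h
      exact hi (by rw [← (letter_bijective A).1 h]; simp)
    simp [List.count_replicate, this]
  · simp

theorem flatMap_replicate_rev_pairwise {A : Type*} [LinearOrder A] [Fintype A] (w : List A) :
    ((List.finRange (Fintype.card A)).flatMap
      (fun i => List.replicate (w.count (letter A (Fin.revPerm i)))
        (letter A (Fin.revPerm i)))).Pairwise (· ≥ ·) := by
  rw [List.pairwise_flatMap]
  refine ⟨fun i _ => List.pairwise_replicate.2 (Or.inr le_rfl), ?_⟩
  refine (List.pairwise_lt_finRange _).imp ?_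
  intro i j hij x hx y hy
  rw [List.eq_of_mem_replicate hx, List.eq_of_mem_replicate hy]
  exact (letter_strictMono A).monotone (by simpa using hij.le)

/-- Being perfectly clustering means that the Burrows–Wheeler transform is a weakly decreasing
rearrangement of the word. -/
theorem isPerfectlyClustering_iff {A : Type*} [LinearOrder A] [Fintype A] (w : List A) :
    IsPerfectlyClustering w ↔ IsPrimitive w ∧ (bw w).Perm w ∧ (bw w).Pairwise (· ≥ ·) := by
  refine and_congr_right fun _ => ⟨fun h => ?_, fun h => ?_⟩
  · rw [h]
    exact ⟨flatMap_replicate_perm _ w, flatMap_replicate_rev_pairwise w⟩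
  · exact List.Perm.eq_of_pairwise (fun a b _ _ h₁ h₂ => le_antisymm h₂ h₁) h.2
      (flatMap_replicate_rev_pairwise w) (h.1.trans (flatMap_replicate_perm _ w).symm)

/-! ### Symmetric interval exchanges and the words they code -/

/-- A discrete symmetric interval exchange on `{0, …, n}` consisting of a single cycle, whose
intervals are the level sets of the weakly increasing colouring `c`.  The permutation `T` increases
on each interval, and it puts the images of the intervals in decreasing order of colours; this
determines `T` from the lengths of the intervals. -/
structure SymmetricExchange (A : Type*) [LinearOrder A] (n : ℕ) where
  /-- the transformation -/
  T : Equiv.Perm (Fin (n + 1))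
  /-- the letter attached to each point -/
  c : Fin (n + 1) → A
  cycle : T.IsCycleOn (Finset.univ : Finset (Fin (n + 1)))
  mono : Monotone c
  anti : Antitone (c ∘ T.symm)
  lt_of_lt : ∀ x y, x < y → c x = c y → T x < T y

namespace SymmetricExchange

variable {A : Type*} [LinearOrder A] {n : ℕ} (E : SymmetricExchange A n)

/-- The letters met along the orbit of `x`. -/
def word (x : Fin (n + 1)) : List A :=
  (List.range (n + 1)).map fun i => E.c ((E.T ^ i) x)

@[simp] theorem length_word (x : Fin (n + 1)) : (E.word x).length = n + 1 := by simp [word]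

theorem T_pow : E.T ^ (n + 1) = 1 := by
  ext1 x
  have := E.cycle.pow_card_apply (Finset.mem_univ x)
  simpa using this

theorem pow_eq_self_iff (x : Fin (n + 1)) (i : ℕ) : (E.T ^ i) x = x ↔ n + 1 ∣ i := by
  have := E.cycle.pow_apply_eq (Finset.mem_univ x) (n := i)
  simpa using this

theorem pow_mod (i : ℕ) : E.T ^ (i % (n + 1)) = E.T ^ i :=
  (pow_eq_pow_mod i E.T_pow).symm

theorem exists_pow (x y : Fin (n + 1)) : ∃ i < n + 1, (E.T ^ i) x = y := by
  have := E.cycle.exists_pow_eq (Finset.mem_univ x) (Finset.mem_univ y)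
  simpa using this

theorem word_pow (x : Fin (n + 1)) (i : ℕ) : E.word ((E.T ^ i) x) = (E.word x).rotate i := by
  apply List.ext_getElem
  · simp
  · intro j h₁ h₂
    simp only [word, List.getElem_rotate, List.getElem_map, List.getElem_range, List.length_map,
      List.length_range, E.pow_mod]
    rw [pow_add, Equiv.Perm.mul_apply]

theorem mem_iff_isRotated (x : Fin (n + 1)) (v : List A) :
    E.word x ~r v ↔ ∃ y, E.word y = v := by
  constructor
  · rintro ⟨i, rfl⟩
    exact ⟨_, E.word_pow x i⟩
  · rintro ⟨y, rfl⟩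
    obtain ⟨i, -, rfl⟩ := E.exists_pow x y
    exact ⟨i, (E.word_pow x i).symm⟩

/-! ### Words coded by symmetric exchanges are perfectly clustering Lyndon words -/

theorem map_range_le_of_lt (m : ℕ) : ∀ x y : Fin (n + 1), x < y →
    (List.range m).map (fun i => E.c ((E.T ^ i) x)) ≤
      (List.range m).map (fun i => E.c ((E.T ^ i) y)) := by
  induction m with
  | zero => intro x y _; simp
  | succ m ih =>
    intro x y hxy
    simp only [List.range_succ_eq_map, List.map_cons, List.map_map, cons_le_cons_iff_lt_or]
    rcases (E.mono hxy.le).lt_or_eq with h | h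
    · exact Or.inl (by simpa using h)
    · refine Or.inr ⟨by simpa using h, ?_⟩
      have := ih _ _ (E.lt_of_lt x y hxy h)
      simp only [← Equiv.Perm.mul_apply, ← pow_succ] at this
      exact this

/-- If two points coded the same word, `T ^ i` would preserve their order for all `i`, although
some power of `T` sends the smaller one to the largest point. -/
theorem word_injective : Function.Injective E.word := by
  have key : ∀ x y : Fin (n + 1), x < y → E.word x ≠ E.word y := by
    intro x y hxy h
    have hc : ∀ i, E.c ((E.T ^ i) x) = E.c ((E.T ^ i) y) := by
      intro i
      rw [← E.pow_mod]
      have hi : i % (n + 1) < n + 1 := Nat.mod_lt _ (by omega)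
      have := congrArg (fun l : List A => l[i % (n + 1)]?) h
      simpa [word, hi] using this
    have hlt : ∀ i, (E.T ^ i) x < (E.T ^ i) y := by
      intro i
      induction i with
      | zero => simpa using hxy
      | succ i ih =>
        rw [pow_succ', Equiv.Perm.mul_apply, Equiv.Perm.mul_apply]
        exact E.lt_of_lt _ _ ih (hc i)
    obtain ⟨i, -, hi⟩ := E.exists_pow x (Fin.last n)
    exact absurd (hlt i) (by rw [hi]; exact (Fin.le_last _).not_gt)
  intro x y h
  rcases lt_trichotomy x y with h' | h' | h'
  · exact absurd h (key _ _ h')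
  · exact h'
  · exact absurd h.symm (key _ _ h')

theorem word_strictMono : StrictMono E.word := fun x y h =>
  lt_of_le_of_ne (E.map_range_le_of_lt (n + 1) x y h) (fun e => h.ne (E.word_injective e))

theorem getLast?_word (x : Fin (n + 1)) : (E.word x).getLast? = some (E.c (E.T.symm x)) := by
  have : (E.T ^ n) x = E.T.symm x := by
    rw [Equiv.eq_symm_apply, ← Equiv.Perm.mul_apply, ← pow_succ', E.T_pow, Equiv.Perm.one_apply]
  rw [word, List.range_succ, List.map_append, List.getLast?_append]
  simp [this]

theorem bwRows_word (x : Fin (n + 1)) : bwRows (E.word x) = List.ofFn E.word := by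
  refine List.Pairwise.eq_of_mem_iff (r := (· < ·)) (pairwise_bwRows _) ?_ ?_
  · rw [List.pairwise_ofFn]
    exact fun i j h => E.word_strictMono h
  · intro v
    rw [mem_bwRows, List.mem_ofFn, E.mem_iff_isRotated]

theorem bw_word (x : Fin (n + 1)) : bw (E.word x) = List.ofFn (E.c ∘ E.T.symm) := by
  rw [bw, E.bwRows_word, List.ofFn_eq_map, List.ofFn_eq_map, List.filterMap_map,
    ← List.filterMap_eq_map]
  congr 1
  funext y
  exact E.getLast?_word y

theorem ofFn_perm_word (x : Fin (n + 1)) : (List.ofFn E.c).Perm (E.word x) := by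
  have h : E.word x = List.ofFn (fun i : Fin (n + 1) => E.c ((E.T ^ (i : ℕ)) x)) := by
    apply List.ext_getElem
    · simp
    · intro i h₁ h₂
      simp only [word, List.getElem_map, List.getElem_range, List.getElem_ofFn]
  have hb : Function.Bijective (fun i : Fin (n + 1) => (E.T ^ (i : ℕ)) x) := by
    rw [← Finite.surjective_iff_bijective]
    intro y
    obtain ⟨i, hi, h⟩ := E.exists_pow x y
    exact ⟨⟨i, hi⟩, h⟩
  rw [h]
  exact (Equiv.Perm.ofFn_comp_perm (Equiv.ofBijective _ hb) E.c).symm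

theorem isPerfectlyClustering_word [Fintype A] (x : Fin (n + 1)) (hw : IsPrimitive (E.word x)) :
    IsPerfectlyClustering (E.word x) := by
  rw [isPerfectlyClustering_iff, E.bw_word]
  refine ⟨hw, (Equiv.Perm.ofFn_comp_perm E.T.symm E.c).trans (E.ofFn_perm_word x), ?_⟩
  rw [List.pairwise_ofFn]
  exact fun i j h => E.anti h.le

theorem isLyndon_word (hw : IsPrimitive (E.word 0)) : IsLyndon (E.word 0) := by
  refine ⟨hw, fun v hv => ?_⟩
  obtain ⟨y, rfl⟩ := (E.mem_iff_isRotated 0 v).1 hv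
  exact E.word_strictMono.monotone (Fin.zero_le y)

end SymmetricExchange

/-! ### Perfectly clustering Lyndon words are coded by symmetric exchanges -/

/-- The rows of the Burrows–Wheeler matrix, numbered in increasing order, carry the exchange: `T`
moves the first letter of a row to its end and `c` reads the first letter. -/
theorem exists_exchange_of_isPerfectlyClustering {A : Type*} [LinearOrder A] [Fintype A]
    {w : List A} (hw : w ≠ []) (hc : IsPerfectlyClustering w) (hl : IsLyndon w) :
    ∃ (n : ℕ) (E : SymmetricExchange A n), w = E.word 0 := by
  obtain ⟨-, hperm, hdec⟩ := (isPerfectlyClustering_iff w).1 hc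
  obtain ⟨n, hn⟩ : ∃ n, w.length = n + 1 := Nat.exists_eq_succ_of_ne_zero (by simpa using hw)
  -- the transform has full length, so that there are as many distinct conjugates as letters
  have hlen : (bwRows w).length = n + 1 := by
    apply le_antisymm
    · rw [bwRows, Finset.length_sort, ← hn, ← List.length_cyclicPermutations_of_ne_nil w hw]
      exact List.toFinset_card_le _
    · rw [← hn, ← hperm.length_eq]
      exact List.length_filterMap_le _ _
  let row : Fin (n + 1) → List A := fun i => (bwRows w)[(i : ℕ)]'(by omega)
  have hrow : StrictMono row := fun i j h =>
    List.pairwise_iff_getElem.1 (pairwise_bwRows w) _ _ _ _ h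
  have hrows : bwRows w = List.ofFn row := by
    apply List.ext_getElem
    · simp [hlen]
    · intro i h₁ h₂
      simp only [row, List.getElem_ofFn]
  have hmem : ∀ v, w ~r v ↔ ∃ i, row i = v := by
    intro v
    rw [← mem_bwRows, hrows, List.mem_ofFn]
  have hrot : ∀ i, w ~r row i := fun i => (hmem _).2 ⟨i, rfl⟩
  have hlr : ∀ i, (row i).length = n + 1 := fun i => by rw [← (hrot i).perm.length_eq, hn]
  choose f hf using fun i => (hmem ((row i).rotate 1)).1 ((hrot i).trans ⟨1, rfl⟩)
  have hfinj : Function.Injective f := by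
    intro i j h
    apply hrow.injective
    apply List.rotate_injective 1
    dsimp only
    rw [← hf, ← hf, h]
  let T : Equiv.Perm (Fin (n + 1)) :=
    Equiv.ofBijective f (Finite.injective_iff_bijective.1 hfinj)
  have hT : ∀ i, row (T i) = (row i).rotate 1 := hf
  have hTpow : ∀ (m : ℕ) i, row ((T ^ m) i) = (row i).rotate m := by
    intro m
    induction m with
    | zero => simp
    | succ m ih =>
      intro i
      rw [pow_succ', Equiv.Perm.mul_apply, hT, ih, List.rotate_rotate]
  let c : Fin (n + 1) → A := fun i => (row i)[0]'(by rw [hlr]; omega)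
  have hcons : ∀ i, ∃ u, row i = c i :: u ∧ u.length = n := by
    intro i
    have := hlr i
    rcases h : row i with _ | ⟨a, u⟩
    · simp [h] at this
    · exact ⟨u, by simp [c, h], by simpa [h] using this⟩
  have hlast : ∀ i, (row (T i)).getLast? = some (c i) := by
    intro i
    obtain ⟨u, hu, -⟩ := hcons i
    rw [hT, hu, List.rotate_cons_succ]
    simp
  have hbw : bw w = List.ofFn (c ∘ T.symm) := by
    rw [bw, hrows, List.ofFn_eq_map, List.ofFn_eq_map, List.filterMap_map,
      ← List.filterMap_eq_map]
    congr 1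
    funext y
    have := hlast (T.symm y)
    rw [Equiv.apply_symm_apply] at this
    exact this
  have h0 : row 0 = w := by
    obtain ⟨i, hi⟩ := (hmem w).1 (List.IsRotated.refl w)
    exact le_antisymm (hi ▸ hrow.monotone (Fin.zero_le i)) (hl.2 _ (hrot 0))
  have htrans : ∀ x, ∃ i, (T ^ i) 0 = x := by
    intro x
    obtain ⟨i, hi⟩ := hrot x
    exact ⟨i, hrow.injective (by rw [hTpow, h0, hi])⟩
  refine ⟨n, ⟨T, c, ?_, ?_, ?_, ?_⟩, ?_⟩
  · refine ⟨by simp, fun x _ y _ => ?_⟩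
    obtain ⟨i, rfl⟩ := htrans x
    obtain ⟨j, rfl⟩ := htrans y
    simpa using Equiv.Perm.SameCycle.refl T 0
  · intro i j hij
    obtain ⟨u, hu, -⟩ := hcons i
    obtain ⟨v, hv, -⟩ := hcons j
    have := hrow.monotone hij
    rw [hu, hv, cons_le_cons_iff_lt_or] at this
    rcases this with h | h
    · exact h.le
    · exact h.1.le
  · rw [hbw, List.pairwise_ofFn] at hdec
    intro i j hij
    rcases hij.lt_or_eq with h | rfl
    · exact hdec h
    · exact le_rfl
  · intro i j hij hcij
    obtain ⟨u, hu, hul⟩ := hcons i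
    obtain ⟨v, hv, hvl⟩ := hcons j
    rw [← hrow.lt_iff_lt, hT, hT, hu, hv, List.rotate_cons_succ, List.rotate_cons_succ,
      List.rotate_zero, List.rotate_zero]
    have := hrow hij
    rw [hu, hv, List.cons_lt_cons_iff] at this
    rcases this with h | h
    · exact absurd hcij h.ne
    · exact append_lt_append_of_lt _ _ _ _ (by omega) h.2
  · apply List.ext_getElem
    · simp [hn]
    · intro i h₁ h₂
      simp only [SymmetricExchange.word, List.getElem_map, List.getElem_range, c, hTpow, h0,
        List.getElem_rotate, Nat.zero_add]
      congr 1
      exact (Nat.mod_eq_of_lt h₁).symm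

/-! ### An exchange from two almost commuting permutations -/

section

open Equiv.Perm

variable {A : Type*} [LinearOrder A] {n : ℕ} {R D : Equiv.Perm (Fin (n + 1))}
  {c : Fin (n + 1) → A} {p : Fin (n + 1)} {L : Set (Fin (n + 1))}

/-- Along a cycle of `D` avoiding `p` the letters would decrease weakly, and strictly at a point
of `L`. -/
theorem sameCycle_of_mem (hc : ∀ x, x ∉ L → c (D x) = c x)
    (hlt : ∀ x ∈ L, x ≠ p → c (D x) < c x) {x : Fin (n + 1)} (hx : x ∈ L) : D.SameCycle p x := by
  by_contra hp
  have hne : ∀ i : ℕ, (D ^ i) x ≠ p := fun i hi => hp 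
    ⟨-i, by rw [zpow_neg, inv_eq_iff_eq]; simpa using hi.symm⟩
  have hle : ∀ i : ℕ, c ((D ^ (i + 1)) x) ≤ c (D x) := by
    intro i
    induction i with
    | zero => simp
    | succ i ih =>
      refine le_trans ?_ ih
      rw [pow_succ', Equiv.Perm.mul_apply]
      by_cases h : (D ^ (i + 1)) x ∈ L
      · exact (hlt _ h (hne _)).le
      · exact (hc _ h).le
  have h0 := orderOf_pos D
  have := hle (orderOf D - 1)
  rw [Nat.sub_add_cancel h0, pow_orderOf_eq_one] at this
  exact absurd (hlt x hx (by simpa using hne 0)) (not_lt.2 this)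

/-- The complement of the `D`-cycle of `p` contains no point of `L`, and `R`, which commutes with
`D` there, maps it to itself; as `R` is a single cycle, this complement is empty. -/
theorem isCycleOn_of_commute_off (hR : R.IsCycleOn (Finset.univ : Finset (Fin (n + 1))))
    (hc : ∀ x, x ∉ L → c (D x) = c x) (hcomm : ∀ x, x ∉ L → D (R x) = R (D x))
    (hlt : ∀ x ∈ L, x ≠ p → c (D x) < c x) (hp : R.symm p ∈ L) :
    D.IsCycleOn (Finset.univ : Finset (Fin (n + 1))) := by
  have hL : ∀ x ∈ L, D.SameCycle p x := fun x hx => sameCycle_of_mem hc hlt hx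
  have hclosed : ∀ x, ¬ D.SameCycle p x → ¬ D.SameCycle p (R x) := by
    intro x hx hRx
    have hi : ∀ i : ℕ, (D ^ i) (R x) = R ((D ^ i) x) := by
      intro i
      induction i with
      | zero => simp
      | succ i ih =>
        rw [pow_succ', Equiv.Perm.mul_apply, Equiv.Perm.mul_apply, ih]
        exact hcomm _ fun h => hx ((sameCycle_pow_right).1 (hL _ h))
    obtain ⟨i, -, hi'⟩ := hRx.symm.exists_pow_eq'
    rw [hi, ← Equiv.eq_symm_apply] at hi'
    apply hx
    have := hL _ hp
    rw [← hi'] at this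
    exact (sameCycle_pow_right).1 this
  have hall : ∀ x, D.SameCycle p x := by
    intro x
    by_contra hx
    obtain ⟨i, -, hi⟩ := hR.exists_pow_eq (Finset.mem_univ x) (Finset.mem_univ p)
    have : ∀ i : ℕ, ¬ D.SameCycle p ((R ^ i) x) := by
      intro i
      induction i with
      | zero => simpa using hx
      | succ i ih =>
        rw [pow_succ', Equiv.Perm.mul_apply]
        exact hclosed _ ih
    exact this i (hi ▸ SameCycle.refl D p)
  exact ⟨by simp, fun x _ y _ => (hall x).symm.trans (hall y)⟩

/-- Numbering the points as `p, D⁻¹ p, D⁻² p, …` turns `R` into a symmetric interval exchange. -/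
theorem exists_exchange_of_commute_off
    (hR : R.IsCycleOn (Finset.univ : Finset (Fin (n + 1))))
    (hc : ∀ x, x ∉ L → c (D x) = c x) (hcomm : ∀ x, x ∉ L → D (R x) = R (D x))
    (hlt : ∀ x ∈ L, x ≠ p → c (D x) < c x) (hp : R.symm p ∈ L)
    (hle : ∀ x ∈ L, R x ≠ p → c x ≤ c (R.symm (D (R x)))) :
    ∃ E : SymmetricExchange A n, ∀ i : ℕ, E.c ((E.T ^ i) 0) = c ((R ^ i) p) := by
  have hD := isCycleOn_of_commute_off hR hc hcomm hlt hp
  let f : Fin (n + 1) → Fin (n + 1) := fun r => (D⁻¹ ^ (r : ℕ)) p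
  have hf : Function.Surjective f := by
    intro x
    have hD' : (D⁻¹).IsCycleOn ((Finset.univ : Finset (Fin (n + 1))) : Set (Fin (n + 1))) :=
      hD.inv
    obtain ⟨i, hi, h⟩ := hD'.exists_pow_eq (Finset.mem_univ p) (Finset.mem_univ x)
    exact ⟨⟨i, by simpa using hi⟩, h⟩
  let e : Equiv.Perm (Fin (n + 1)) := Equiv.ofBijective f (Finite.surjective_iff_bijective.1 hf)
  have he0 : e 0 = p := by
    change (D⁻¹ ^ 0) p = p
    rw [pow_zero, Equiv.Perm.one_apply]
  have hsucc : ∀ i : Fin n, D (e i.succ) = e i.castSucc := by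
    intro i
    change D ((D⁻¹ ^ ((i : ℕ) + 1)) p) = (D⁻¹ ^ (i : ℕ)) p
    rw [pow_succ', Equiv.Perm.mul_apply]
    exact D.apply_symm_apply _
  have hne : ∀ i : Fin n, e i.succ ≠ p := by
    intro i h
    rw [← he0] at h
    exact (Fin.succ_ne_zero i) (e.injective h)
  let T : Equiv.Perm (Fin (n + 1)) := e⁻¹ * R * e
  have hT : ∀ x, T x = e.symm (R (e x)) := fun x => rfl
  have hT' : ∀ x, T.symm x = e.symm (R.symm (e x)) := fun x => rfl
  have hTpow : ∀ (i : ℕ) x, (T ^ i) x = e.symm ((R ^ i) (e x)) := by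
    intro i
    induction i with
    | zero => simp
    | succ i ih =>
      intro x
      rw [pow_succ', Equiv.Perm.mul_apply, ih, hT, Equiv.apply_symm_apply, pow_succ',
        Equiv.Perm.mul_apply]
  have hmono : Monotone (c ∘ e) := by
    rw [Fin.monotone_iff_le_succ]
    intro i
    simp only [Function.comp_apply, ← hsucc]
    by_cases h : e i.succ ∈ L
    · exact (hlt _ h (hne i)).le
    · exact (hc _ h).le
  refine ⟨⟨T, c ∘ e, ⟨by simp, ?_⟩, hmono, ?_, ?_⟩, ?_⟩
  · intro x _ y _
    obtain ⟨i, -, hi⟩ := hR.exists_pow_eq (Finset.mem_univ (e x)) (Finset.mem_univ (e y))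
    exact ⟨i, by rw [zpow_natCast, hTpow, hi, Equiv.symm_apply_apply]⟩
  · rw [Fin.antitone_iff_succ_le]
    intro i
    simp only [Function.comp_apply, hT', Equiv.apply_symm_apply, ← hsucc]
    by_cases h : R.symm (e i.succ) ∈ L
    · have := hle _ h (by rw [Equiv.apply_symm_apply]; exact hne i)
      rwa [Equiv.apply_symm_apply] at this
    · have h' := hcomm _ h
      rw [Equiv.apply_symm_apply] at h'
      rw [h', Equiv.symm_apply_apply, hc _ h]
  · have hstep : ∀ i : Fin n, (c ∘ e) i.castSucc = (c ∘ e) i.succ → T i.castSucc < T i.succ := by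
      intro i hi
      simp only [Function.comp_apply, ← hsucc] at hi
      have h : e i.succ ∉ L := fun h => (hlt _ h (hne i)).ne hi
      have hT0 : T i.succ ≠ 0 := by
        intro h0
        apply h
        rw [hT, Equiv.symm_apply_eq, he0, ← Equiv.eq_symm_apply] at h0
        rwa [h0]
      obtain ⟨j, hj⟩ := Fin.exists_succ_eq.2 hT0
      have : T i.castSucc = j.castSucc := by
        rw [hT, Equiv.symm_apply_eq, ← hsucc, ← hsucc, ← hcomm _ h, hj, hT,
          Equiv.apply_symm_apply]
      rw [this, ← hj]
      exact Fin.castSucc_lt_succ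
    intro x y
    induction y using Fin.induction with
    | zero => intro h; exact absurd h (Fin.not_lt_zero _)
    | succ i ih =>
      intro hxi hcx
      have hxi' : x ≤ i.castSucc := Fin.le_castSucc_iff.2 hxi
      have h1 := hmono hxi'
      have h2 := hmono (Fin.castSucc_lt_succ (i := i)).le
      have h3 : (c ∘ e) i.castSucc = (c ∘ e) i.succ := le_antisymm h2 (hcx ▸ h1)
      rcases hxi'.lt_or_eq with h | h
      · exact (ih h (hcx.trans h3.symm)).trans (hstep i h3)
      · rw [h]
        exact hstep i h3
  · intro i
    simp only [Function.comp_apply, hTpow, Equiv.apply_symm_apply, he0]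

end

/-! ### Special factorizations and reversal -/

theorem interleave_append_singleton {A : Type*} (a : A) (p : List A) :
    ∀ (l : List A) (ps : List (List A)), ps.length + 1 = l.length →
      interleave (l ++ [a]) (ps ++ [p]) = interleave l ps ++ p ++ [a]
  | [], _, h => by simp at h
  | [b], [], _ => by simp [interleave]
  | [b], _ :: _, h => by simp at h
  | b :: b' :: l, [], h => by simp at h
  | b :: b' :: l, q :: qs, h => by
    have := interleave_append_singleton a p (b' :: l) qs (by simpa using h)
    simp only [List.cons_append] at this
    simp [interleave, this]

theorem reverse_interleave {A : Type*} :
    ∀ (l : List A) (ps : List (List A)), ps.length + 1 = l.length →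
      (interleave l ps).reverse = interleave l.reverse (ps.map List.reverse).reverse
  | [], _, h => by simp at h
  | [b], [], _ => by simp [interleave]
  | [b], _ :: _, h => by simp at h
  | b :: b' :: l, [], h => by simp at h
  | b :: b' :: l, q :: qs, h => by
    have := reverse_interleave (b' :: l) qs (by simpa using h)
    rw [List.map_cons, List.reverse_cons (a := b), List.reverse_cons (a := q.reverse),
      interleave_append_singleton _ _ _ _ (by simpa using h), ← this]
    simp [interleave]

theorem getElem?_cons_append {A : Type*} (a : A) (p v : List A) (x : ℕ) :
    (a :: (p ++ v))[x]? =
      if x = 0 then some a else if x ≤ p.length then p[x - 1]? else v[x - (p.length + 1)]? := by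
  rcases x with _ | x
  · simp
  · simp only [List.getElem?_cons_succ, List.getElem?_append, Nat.add_sub_cancel]
    grind

theorem getElem?_zero_interleave {A : Type*} (a : A) (l : List A) (π : List (List A)) :
    (interleave (a :: l) π)[0]? = some a := by
  cases π <;> simp [interleave]

/-- In a word `w = a₁π₁a₂⋯aₖ`, with distinguished positions `P₁ < ⋯ < Pₖ`, let `ν` reflect each
interval `(Pⱼ, Pⱼ₊₁]` onto `[Pⱼ, Pⱼ₊₁)`.  Off the set `L` of distinguished positions `ν` matches
the letters of `w` with those of `a₁π̃₁a₂⋯aₖ`, and it shifts the distinguished letters by one. -/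
theorem exists_reflection {A : Type*} [LinearOrder A] :
    ∀ (a : A) (l : List A) (π : List (List A)), π.length = l.length →
      (a :: l).Pairwise (· < ·) →
      ∃ (w w' : List A) (ν : ℕ → ℕ) (L : Set ℕ), w = interleave (a :: l) π ∧
        w' = interleave (a :: l) (π.map List.reverse) ∧ w'.length = w.length ∧
        0 < w.length ∧ w.length - 1 ∈ L ∧
        (∀ x, 1 ≤ x → x < w.length → ν x + 1 < w.length) ∧
        (∀ x y, 1 ≤ x → 1 ≤ y → x < w.length → y < w.length → ν x = ν y → x = y) ∧
        0 ∈ L ∧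
        (∀ x < w.length, x ∉ L → w'[ν x]? = w[x]?) ∧
        (∀ x < w.length, x ∉ L → ν (x + 1) + 1 = ν x) ∧
        (∀ x ∈ L, 1 ≤ x → x < w.length → ∀ y z, w'[ν x]? = some y → w[x]? = some z → y < z) ∧
        (∀ x ∈ L, x + 1 < w.length →
          ∀ y z, w[x]? = some y → w'[ν (x + 1) + 1]? = some z → y ≤ z)
  | a, [], [], _, _ =>
    ⟨_, _, id, Set.univ, rfl, rfl, by simp [interleave], by simp [interleave], by simp,
      by simp [interleave]; omega, by simp [interleave], by simp, by simp, by simp,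
      by simp [interleave]; omega, by simp [interleave]⟩
  | a, [], _ :: _, h, _ => by simp at h
  | a, b :: l, [], h, _ => by simp at h
  | a, b :: l, p :: ps, h, hs => by
    obtain ⟨w, w', ν, L, hw, hw', hlen, hpos, hlast, hbd, hinj, h0, hoff, hstep, hlt, hle⟩ :=
      exists_reflection b l ps (by simpa using h) hs.of_cons
    have hab : a < b := by
      rw [List.pairwise_cons] at hs
      exact hs.1 b (by simp)
    have hw0 : w[0]? = some b := by rw [hw, getElem?_zero_interleave]
    have hw'0 : w'[0]? = some b := by rw [hw', getElem?_zero_interleave]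
    have e := getElem?_cons_append a p w
    have e' := getElem?_cons_append a p.reverse w'
    rw [List.length_reverse] at e'
    obtain ⟨μ, hμ, hμ'⟩ : ∃ μ : ℕ → ℕ, (∀ x ≤ p.length + 1, μ x = p.length + 1 - x) ∧
        ∀ x, p.length + 1 < x → μ x = ν (x - (p.length + 1)) + (p.length + 1) :=
      ⟨fun x => if x ≤ p.length + 1 then p.length + 1 - x
        else ν (x - (p.length + 1)) + (p.length + 1),
        fun x hx => if_pos hx, fun x hx => if_neg (by omega)⟩
    refine ⟨a :: (p ++ w), a :: (p.reverse ++ w'), μ,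
      {x | x = 0 ∨ p.length + 1 ≤ x ∧ x - (p.length + 1) ∈ L}, by rw [hw]; rfl,
      by rw [hw']; rfl, by simp [hlen], by simp, ?_, ?_, ?_, by simp, ?_, ?_, ?_, ?_⟩
    all_goals simp only [List.length_cons, List.length_append, Set.mem_ofPred_eq]
    · right
      refine ⟨by omega, ?_⟩
      convert hlast using 1
      omega
    · intro x h1 hx
      have := hbd (x - (p.length + 1))
      rcases le_or_gt x (p.length + 1) with hx' | hx'
      · rw [hμ x hx']
        omega
      · rw [hμ' x hx']
        omega
    · intro x y hx1 hy1 hx hy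
      have := hinj (x - (p.length + 1)) (y - (p.length + 1))
      rcases le_or_gt x (p.length + 1) with hx' | hx' <;>
        rcases le_or_gt y (p.length + 1) with hy' | hy' <;>
        simp only [hμ, hμ', hx', hy'] <;> omega
    · intro x hx hxL
      rw [not_or, not_and] at hxL
      rw [e, e', if_neg hxL.1]
      by_cases hxp : x ≤ p.length
      · rw [hμ x (by omega), if_neg (by omega), if_pos (by omega), if_pos hxp,
          List.getElem?_reverse (by omega)]
        congr 1
        omega
      · have hx' := hxL.2 (by omega)
        have : x - (p.length + 1) ≠ 0 := fun h => hx' (h ▸ h0)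
        rw [hμ' x (by omega), if_neg (by omega), if_neg (by omega), if_neg hxp,
          Nat.add_sub_cancel]
        exact hoff _ (by omega) hx'
    · intro x hx hxL
      rw [not_or, not_and] at hxL
      by_cases hxp : x ≤ p.length
      · rw [hμ x (by omega), hμ (x + 1) (by omega)]
        omega
      · have hx' := hxL.2 (by omega)
        have : x - (p.length + 1) ≠ 0 := fun h => hx' (h ▸ h0)
        rw [hμ' x (by omega), hμ' (x + 1) (by omega)]
        have := hstep _ (by omega) hx'
        rw [show x + 1 - (p.length + 1) = x - (p.length + 1) + 1 by omega]
        omega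
    · rintro x (rfl | ⟨hxp, hxL⟩) hx1 hx y z
      · omega
      · rw [e, e']
        rcases hxp.eq_or_lt with rfl | hxp
        · simp [hw0, hμ]
          rintro rfl rfl
          exact hab
        · rw [hμ' x hxp, if_neg (by omega), if_neg (by omega), if_neg (by omega),
            if_neg (by omega), Nat.add_sub_cancel]
          exact hlt _ hxL (by omega) (by omega) y z
    · rintro x (rfl | ⟨hxp, hxL⟩) hx y z
      · rw [e, e']
        simp [hw'0, hμ]
        rintro rfl rfl
        exact hab.le
      · rw [e, e', hμ' (x + 1) (by omega), if_neg (by omega), if_neg (by omega),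
          if_neg (by omega), if_neg (by omega)]
        rw [show x + 1 - (p.length + 1) = x - (p.length + 1) + 1 by omega,
          show ν (x - (p.length + 1) + 1) + (p.length + 1) + 1 - (p.length + 1) =
            ν (x - (p.length + 1) + 1) + 1 by omega]
        exact hle _ hxL (by omega) y z


theorem pairwise_letters {A : Type*} [LinearOrder A] (w : List A) :
    (letters w).Pairwise (· < ·) :=
  (Finset.sortedLT_sort _).pairwise

theorem specialReverse_reverse {A : Type*} [LinearOrder A] {w : List A} {π : List (List A)}
    (h : π.length + 1 = (letters w).length) :
    specialReverse w π = (interleave (letters w) (π.map List.reverse)).reverse := by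
  rw [reverse_interleave _ _ (by simpa using h), List.map_map, List.reverse_involutive.comp_self,
    List.map_id, specialReverse]

theorem rev_eq_rev_add_one {n : ℕ} {y z : Fin (n + 1)} (h : (z : ℕ) + 1 = y) :
    Fin.rev z = Fin.rev y + 1 := by
  have hy := y.isLt
  have h1 : ((1 : Fin (n + 1)) : ℕ) = 1 := by
    rw [Fin.val_one', Nat.mod_eq_of_lt (by omega)]
  ext
  rw [Fin.val_add, Fin.val_rev, Fin.val_rev, h1, Nat.mod_eq_of_lt (by omega)]
  omega

theorem addRight_one_pow_zero {n : ℕ} (i : ℕ) :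
    (((Equiv.addRight (1 : Fin (n + 1))) ^ i) 0 : Fin (n + 1)) = Fin.ofNat (n + 1) i := by
  induction i with
  | zero => simp
  | succ i ih =>
    rw [pow_succ', Equiv.Perm.mul_apply, ih]
    ext
    simp [Fin.val_add]

/-- The rotation carrying the reversal of `W` back to `w`, composed with the reflection `ν`, gives
a permutation `D` of the positions of `w` that commutes with the shift `x ↦ x + 1` off the
distinguished positions. -/
theorem exists_exchange_of_isRotated_specialReverse {A : Type*} [LinearOrder A] {w : List A}
    {π : List (List A)} (hπ : IsSpecialFactorization w π) (hrot : w ~r specialReverse w π) :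
    ∃ (n : ℕ) (E : SymmetricExchange A n), w = E.word 0 := by
  obtain ⟨hl, hw⟩ := hπ
  rw [specialReverse_reverse hl] at hrot
  have hs := pairwise_letters w
  obtain ⟨a, l, hal⟩ : ∃ a l, letters w = a :: l :=
    List.exists_cons_of_length_pos (by omega)
  rw [hal] at hl hw hrot hs
  obtain ⟨w₀, w', ν, L, hw₀, hw', hlen, hpos, hlast, hbd, hinj, h0, hoff, hstep, hlt, hle⟩ :=
    exists_reflection a l π (by simpa using hl) hs
  obtain rfl : w₀ = w := hw₀.trans hw.symm
  rw [← hw'] at hrot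
  clear hw' hw₀ hw hal hs hl
  obtain ⟨s, hrot⟩ := hrot
  obtain ⟨n, hn⟩ : ∃ n, w₀.length = n + 1 := ⟨w₀.length - 1, by omega⟩
  rw [hn] at hlen hlast
  simp only [hn] at hbd hinj hoff hstep hlt hle
  let c : Fin (n + 1) → A := fun x => w₀[(x : ℕ)]'(by omega)
  have hc : ∀ x : Fin (n + 1), w₀[(x : ℕ)]? = some (c x) := fun x => List.getElem?_eq_getElem _
  let μ : Fin (n + 1) → Fin (n + 1) := fun x =>
    if h : (x : ℕ) = 0 then Fin.last n else ⟨ν x, by have := hbd x (by omega) x.isLt; omega⟩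
  have hμ0 : ∀ x : Fin (n + 1), (x : ℕ) = 0 → (μ x : ℕ) = n := fun x hx => by simp only [μ, dif_pos hx, Fin.val_last]
  have hμ : ∀ x : Fin (n + 1), (x : ℕ) ≠ 0 → (μ x : ℕ) = ν x := fun x hx => by simp only [μ, dif_neg hx]
  have hμinj : Function.Injective μ := by
    intro x y h
    have h' : (μ x : ℕ) = μ y := by rw [h]
    have h1 := hbd x
    have h2 := hbd y
    have h3 := hinj x y
    ext
    by_cases hx : (x : ℕ) = 0 <;> by_cases hy : (y : ℕ) = 0 <;>
      simp only [hμ, hμ0, hx, hy, ne_eq, not_false_eq_true] at h' <;> omega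
  let D : Equiv.Perm (Fin (n + 1)) := Equiv.ofBijective
    (fun x => Fin.ofNat (n + 1) s + Fin.rev (μ x)) (Finite.injective_iff_bijective.1
      fun x y h => hμinj (Fin.rev_injective (add_left_cancel h)))
  have hD : ∀ x, D x = Fin.ofNat (n + 1) s + Fin.rev (μ x) := fun x => rfl
  have hcrev : ∀ y : Fin (n + 1), w'[(y : ℕ)]? = some (c (Fin.ofNat (n + 1) s + Fin.rev y)) := by
    intro y
    have hy := y.isLt
    have h : (w₀.rotate s)[n - (y : ℕ)]? = w'.reverse[n - (y : ℕ)]? := by rw [hrot]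
    rw [List.getElem?_rotate (by omega), List.getElem?_reverse (by omega), hlen,
      show n + 1 - 1 - (n - (y : ℕ)) = y by omega] at h
    rw [← h, ← hc, hn]
    congr 1
    simp [Fin.val_add, Nat.add_comm, Fin.val_rev]
  have hadd : ∀ x : Fin (n + 1), (x : ℕ) + 1 < n + 1 → ((x + 1 : Fin (n + 1)) : ℕ) = x + 1 := by
    intro x hx
    exact Fin.val_add_one_of_lt (Fin.lt_def.2 (by simpa using hx))
  let R : Equiv.Perm (Fin (n + 1)) := Equiv.addRight 1
  have hRs : ∀ x, R.symm x = x - 1 := fun x => by simp [R, sub_eq_add_neg]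
  have hR0 : ∀ i, (R ^ i) 0 = Fin.ofNat (n + 1) i := addRight_one_pow_zero
  have hRx : ∀ x : Fin (n + 1), (R ^ (x : ℕ)) 0 = x := fun x => by rw [hR0]; simp
  have hRc : R.IsCycleOn (Finset.univ : Finset (Fin (n + 1))) := by
    refine ⟨by simp, fun x _ y _ => ?_⟩
    rw [← hRx x, ← hRx y]
    simpa using Equiv.Perm.SameCycle.refl R 0
  have hmem : ∀ x : Fin (n + 1), (x : ℕ) ∉ L → (x : ℕ) ≠ 0 ∧ (x : ℕ) + 1 < n + 1 := by
    intro x hx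
    refine ⟨fun h => hx (h ▸ h0), ?_⟩
    by_contra h
    apply hx
    convert hlast using 1
    omega
  have hex : ∃ E : SymmetricExchange A n, ∀ i : ℕ, E.c ((E.T ^ i) 0) = c ((R ^ i) 0) := by
    refine exists_exchange_of_commute_off (D := D) (L := {x | (x : ℕ) ∈ L}) hRc ?_ ?_ ?_ ?_ ?_
    · intro x hx
      have := hoff x x.isLt hx
      rw [← hμ x (hmem x hx).1, hcrev, hc] at this
      exact Option.some_injective _ this
    · intro x hx
      obtain ⟨hx0, hx1⟩ := hmem x hx
      change D (x + 1) = D x + 1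
      rw [hD, hD, add_assoc]
      congr 1
      apply rev_eq_rev_add_one
      rw [hμ x hx0, hμ _ (by rw [hadd x hx1]; omega), hadd x hx1]
      exact hstep x x.isLt hx
    · intro x hx hx0
      have hx0' : (x : ℕ) ≠ 0 := fun h => hx0 (Fin.ext h)
      refine hlt x hx (by omega) x.isLt _ _ ?_ (hc x)
      rw [← hμ x hx0', hcrev, hD]
    · rw [hRs, Set.mem_ofPred_eq]
      convert hlast using 1
      rw [show (0 : Fin (n + 1)) - 1 = Fin.last n by rw [sub_eq_iff_eq_add, Fin.last_add_one]]
      simp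
    · intro x hx hx0
      have hx1 : (x : ℕ) + 1 < n + 1 := by
        by_contra h
        apply hx0
        have : x = Fin.last n := Fin.ext (by simp; omega)
        rw [this]
        exact Fin.last_add_one n
      have h1 := hadd x hx1
      have hμ1 := hμ (x + 1) (by omega)
      have hbd1 := hbd (x + 1) (by omega) hx1
      rw [h1] at hμ1
      refine hle x hx hx1 _ _ (hc x) ?_
      rw [hRs, show R x = x + 1 from rfl]
      have hy : ν (x + 1) + 1 < n + 1 := by omega
      have := hcrev ⟨ν (x + 1) + 1, hy⟩
      rw [this, hD]
      congr 2
      rw [add_sub_assoc, rev_eq_rev_add_one (y := ⟨ν (x + 1) + 1, hy⟩) (z := μ (x + 1))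
        (by simp [hμ1]), add_sub_cancel_right]
  obtain ⟨E, hE⟩ := hex
  refine ⟨n, E, List.ext_getElem (by simp [hn]) fun i h₁ h₂ => ?_⟩
  simp only [SymmetricExchange.word, List.getElem_map, List.getElem_range, hE, hR0, c]
  congr 1
  simp [Nat.mod_eq_of_lt (hn ▸ h₁)]

/-! ### Palindromic factorizations -/

theorem isRotated_reverse_of_isProductOfTwoPalindromes {A : Type*} {w : List A}
    (h : IsProductOfTwoPalindromes w) : w ~r w.reverse := by
  obtain ⟨p, q, hp, hq, rfl⟩ := h
  rw [List.reverse_append, hp.reverse_eq, hq.reverse_eq]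
  exact List.isRotated_append

theorem exists_isRotated_specialReverse {A : Type*} [LinearOrder A] {w : List A}
    {π : List (List A)} (h : IsProductOfTwoPalindromes w)
    (hπ : IsPalindromicSpecialFactorization w π) : w ~r specialReverse w π := by
  rw [specialReverse_reverse hπ.1.1,
    List.map_congr_left (g := id) (fun p hp => (hπ.2 p hp).reverse_eq), List.map_id, ← hπ.1.2]
  exact isRotated_reverse_of_isProductOfTwoPalindromes h


theorem palindrome_map_range {A : Type*} {u : ℕ → A} {k : ℕ} (h : ∀ i < k, u i = u (k - 1 - i)) :
    ((List.range k).map u).Palindrome := by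
  apply List.Palindrome.of_reverse_eq
  apply List.ext_getElem
  · simp
  · intro i h₁ h₂
    simp only [List.length_reverse, List.length_map, List.length_range] at h₁
    simp [List.getElem_reverse, ← h i h₁]

/-! ### Pairs of involutions -/

section
variable {X : Type*}

/-- An involution `σ` that conjugates `g` to `g⁻¹` reverses the orbits of `g`. -/
theorem involution_pow {g : Equiv.Perm X} {σ : X → X} (h : ∀ z, σ (g z) = g.symm (σ z)) {x y : X} :
    ∀ i j : ℕ, (g ^ (i + j)) y = σ x → σ ((g ^ i) x) = (g ^ j) y
  | 0, j, hij => by simpa using hij.symm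
  | i + 1, j, hij => by
    have := involution_pow h i (j + 1) (by rwa [← add_assoc, add_right_comm])
    rw [pow_succ', Equiv.Perm.mul_apply, h, this, Equiv.symm_apply_eq, pow_succ',
      Equiv.Perm.mul_apply]

theorem mul_pow_mul_mul_pow {α β : Equiv.Perm X} (hα : α * α = 1) (hβ : β * β = 1) (i : ℕ) :
    (α * β) ^ i * α * (α * β) ^ i = α := by
  induction i with
  | zero => simp
  | succ i ih =>
    calc (α * β) ^ (i + 1) * α * (α * β) ^ (i + 1)
        = (α * β) ^ i * (α * β * α * (α * β)) * (α * β) ^ i := by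
          rw [pow_succ (α * β) i]
          nth_rewrite 2 [← pow_succ]
          rw [pow_succ']
          simp only [mul_assoc]
      _ = (α * β) ^ i * α * (α * β) ^ i := by
          congr 2
          calc α * β * α * (α * β) = α * (β * (α * α) * β) := by simp only [mul_assoc]
            _ = α := by rw [hα, mul_one, hβ, mul_one]
      _ = α := ih

variable [Fintype X] [DecidableEq X]

/-- The fixed points of two involutions, counted separately: `(false, z)` stands for a fixed point
of `α` and `(true, z)` for one of `β`. -/
def fixedPairs (α β : Equiv.Perm X) : Finset (Bool × X) :=
  Finset.univ.filter fun p => (if p.1 then β p.2 else α p.2) = p.2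

theorem card_fixedPairs (α β : Equiv.Perm X) :
    (fixedPairs α β).card =
      (Finset.univ.filter fun x => α x = x).card + (Finset.univ.filter fun x => β x = x).card := by
  have h : fixedPairs α β =
      (Finset.univ.filter fun x => α x = x).image (Prod.mk false) ∪
        (Finset.univ.filter fun x => β x = x).image (Prod.mk true) := by
    ext ⟨b, x⟩
    cases b <;> simp [fixedPairs]
  rw [h, Finset.card_union_of_disjoint, Finset.card_image_of_injective _ (Prod.mk_right_injective _),
    Finset.card_image_of_injective _ (Prod.mk_right_injective _)]
  rw [Finset.disjoint_left]
  rintro ⟨b, x⟩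
  simp only [Finset.mem_image]
  rintro ⟨y, -, hy⟩ ⟨z, -, hz⟩
  have := hy.trans hz.symm
  simp at this

/-- A cycle of the product of two involutions contains at most two of their fixed points.  Indeed,
if `α x = (α β) ^ k x` and the cycle has length `t`, then `(α β) ^ i x` can only be fixed by `α`
if `2 i ≡ k`, and by `β` if `2 i + 1 ≡ k` modulo `t`; and `2 i + 1 < 2 t`. -/
theorem card_fixedPairs_sameCycle_le_two {α β : Equiv.Perm X} (hα : α * α = 1) (hβ : β * β = 1)
    {x : X} (hx : (α * β).SameCycle x (α x)) :
    ((fixedPairs α β).filter fun p => (α * β).SameCycle x p.2).card ≤ 2 := by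
  set g := α * β with hg
  have hmod : ∀ i : ℕ, (g ^ (i % Function.minimalPeriod g x)) x = (g ^ i) x := by
    intro i
    rw [← Equiv.Perm.iterate_eq_pow, ← Equiv.Perm.iterate_eq_pow,
      Function.iterate_mod_minimalPeriod_eq]
  set t := Function.minimalPeriod g x with ht
  have ht0 : 0 < t := Function.minimalPeriod_pos_of_mem_periodicPts
    (g.injective.mem_periodicPts x)
  have hinj : ∀ i < t, ∀ j < t, (g ^ i) x = (g ^ j) x → i = j := by
    intro i hi j hj h
    rw [← Equiv.Perm.iterate_eq_pow, ← Equiv.Perm.iterate_eq_pow] at h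
    exact (Function.iterate_eq_iterate_iff_of_lt_minimalPeriod hi hj).1 h
  obtain ⟨k, hk⟩ : ∃ k < t, (g ^ k) x = α x := by
    obtain ⟨k, hk⟩ := hx.exists_nat_pow_eq
    exact ⟨k % t, Nat.mod_lt _ ht0, by rw [hmod, hk]⟩
  let φ : ℕ → Bool × X := fun m => (m % 2 == 1, (g ^ (m / 2)) x)
  have hsub : ((fixedPairs α β).filter fun p => g.SameCycle x p.2) ⊆
      ({k, k + t} : Finset ℕ).image φ := by
    rintro ⟨b, z⟩ hz
    simp only [fixedPairs, Finset.mem_filter, Finset.mem_univ, true_and] at hz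
    obtain ⟨hfix, hz⟩ := hz
    obtain ⟨i, hi, rfl⟩ : ∃ i < t, (g ^ i) x = z := by
      obtain ⟨i, hi⟩ := hz.exists_nat_pow_eq
      exact ⟨i % t, Nat.mod_lt _ ht0, by rw [hmod, hi]⟩
    have hαi : (g ^ i) (α ((g ^ i) x)) = α x := by
      have := congrArg (fun f : Equiv.Perm X => f x) (mul_pow_mul_mul_pow hα hβ i)
      simpa only [Equiv.Perm.mul_apply] using this
    have hmain : ∀ m : ℕ, (g ^ m) x = α x → m < 2 * t → m = k ∨ m = k + t := by
      intro m hm hmt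
      rw [← hk.2, ← hmod m] at hm
      have := hinj _ (Nat.mod_lt _ ht0) _ hk.1 hm
      rcases lt_or_ge m t with h | h
      · left
        rwa [Nat.mod_eq_of_lt h] at this
      · right
        rw [Nat.mod_eq_sub_mod h, Nat.mod_eq_of_lt (by omega)] at this
        omega
    rw [Finset.mem_image]
    cases b
    · have hfix : α ((g ^ i) x) = (g ^ i) x := by simpa using hfix
      refine ⟨2 * i, ?_, by simp [φ]⟩
      rw [Finset.mem_insert, Finset.mem_singleton]
      refine hmain _ ?_ (by omega)
      rw [two_mul, pow_add, Equiv.Perm.mul_apply]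
      rwa [hfix] at hαi
    · have hfix : β ((g ^ i) x) = (g ^ i) x := by simpa using hfix
      have hgi : α ((g ^ i) x) = g ((g ^ i) x) := by rw [hg, Equiv.Perm.mul_apply, ← hg, hfix]
      refine ⟨2 * i + 1, ?_, ?_⟩
      · rw [Finset.mem_insert, Finset.mem_singleton]
        refine hmain _ ?_ (by omega)
        rw [show 2 * i + 1 = i + (1 + i) by omega, pow_add, pow_add, Equiv.Perm.mul_apply,
          Equiv.Perm.mul_apply, pow_one]
        rwa [hgi] at hαi
      · have : (2 * i + 1) / 2 = i := by omega
        simp [φ, this]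
  exact (Finset.card_le_card hsub).trans (Finset.card_image_le.trans Finset.card_le_two)

end

/-! ### The reflections attached to a symmetric exchange -/

namespace SymmetricExchange

variable {A : Type*} [LinearOrder A] {n : ℕ} (E : SymmetricExchange A n)

/-- The map reversing each interval of the exchange. -/
def flip (x : Fin (n + 1)) : Fin (n + 1) := Fin.rev (E.T x)

theorem flip_injective : Function.Injective E.flip :=
  Fin.rev_injective.comp E.T.injective

/-- Both `c ∘ T⁻¹` and `c ∘ rev` are weakly decreasing rearrangements of `c`, so they are equal. -/
theorem c_flip (x : Fin (n + 1)) : E.c (E.flip x) = E.c x := by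
  have h : List.ofFn (E.c ∘ E.T.symm) = List.ofFn (E.c ∘ Fin.revPerm) := by
    refine List.Perm.eq_of_pairwise (le := (· ≥ ·)) (fun a b _ _ h₁ h₂ => le_antisymm h₂ h₁) ?_ ?_
      ((Equiv.Perm.ofFn_comp_perm E.T.symm E.c).trans
        (Equiv.Perm.ofFn_comp_perm Fin.revPerm E.c).symm)
    · rw [List.pairwise_ofFn]
      exact fun i j hij => E.anti hij.le
    · rw [List.pairwise_ofFn]
      exact fun i j hij => E.mono (Fin.rev_le_rev.2 hij.le)
  have := congrFun (List.ofFn_injective h) (E.T x)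
  simp only [Function.comp_apply, Equiv.symm_apply_apply, Fin.revPerm_apply] at this
  exact this.symm

theorem flip_lt_flip {x y : Fin (n + 1)} (h : x < y) (hc : E.c x = E.c y) :
    E.flip y < E.flip x :=
  Fin.rev_lt_rev.2 (E.lt_of_lt x y h hc)

theorem flip_le_flip {x y : Fin (n + 1)} (h : x ≤ y) (hc : E.c x = E.c y) :
    E.flip y ≤ E.flip x := by
  rcases h.lt_or_eq with h | rfl
  · exact (E.flip_lt_flip h hc).le
  · exact le_rfl

/-- `flip ∘ flip` is strictly increasing, hence the identity. -/
@[simp] theorem flip_flip (x : Fin (n + 1)) : E.flip (E.flip x) = x := by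
  have h : StrictMono (E.flip ∘ E.flip) := by
    intro x y hxy
    rcases (E.mono hxy.le).lt_or_eq with hc | hc
    · by_contra h
      have := E.mono (not_lt.1 h)
      simp only [Function.comp_apply, c_flip] at this
      exact absurd hc (not_lt.2 this)
    · exact E.flip_lt_flip (E.flip_lt_flip hxy hc) (by rw [c_flip, c_flip, hc])
  exact le_antisymm (h.le_id x) (h.id_le x)

theorem T_eq_rev_flip (x : Fin (n + 1)) : E.T x = Fin.rev (E.flip x) := by
  rw [flip, Fin.rev_rev]

theorem T_symm_eq_flip_rev (x : Fin (n + 1)) : E.T.symm x = E.flip (Fin.rev x) := by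
  rw [Equiv.symm_apply_eq, T_eq_rev_flip, flip_flip, Fin.rev_rev]

theorem flip_T (x : Fin (n + 1)) : E.flip (E.T x) = E.T.symm (E.flip x) := by
  rw [T_symm_eq_flip_rev, ← T_eq_rev_flip]

theorem isProductOfTwoPalindromes_word : IsProductOfTwoPalindromes (E.word 0) := by
  obtain ⟨m, hm, h⟩ := E.exists_pow 0 (E.flip 0)
  have h' : (E.T ^ (n + 1 + m)) 0 = E.flip 0 := by
    rw [pow_add, E.T_pow, one_mul, h]
  refine ⟨(List.range (m + 1)).map fun i => E.c ((E.T ^ i) 0),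
    (List.range (n - m)).map fun i => E.c ((E.T ^ (m + 1 + i)) 0),
    palindrome_map_range fun i hi => ?_, palindrome_map_range fun i hi => ?_, ?_⟩
  · rw [← E.c_flip, involution_pow E.flip_T i (m + 1 - 1 - i)]
    rw [← h]
    congr 2
    omega
  · rw [← E.c_flip, involution_pow E.flip_T (m + 1 + i) (m + 1 + (n - m - 1 - i))]
    rw [← h']
    congr 2
    omega
  · have hr : List.range (n + 1) = List.range (m + 1) ++ (List.range (n - m)).map (m + 1 + ·) := by
      rw [← List.range_add]
      congr 1
      omega
    rw [word, hr, List.map_append, List.map_map]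
    rfl

/-- `x` is the left end of one of the exchanged intervals. -/
def IsStart (x : Fin (n + 1)) : Prop := ∀ y, E.c y = E.c x → x ≤ y

theorem isStart_zero : E.IsStart 0 := fun y _ => Fin.zero_le y

theorem isStart_succ_iff (i : Fin n) : E.IsStart i.succ ↔ E.c i.castSucc ≠ E.c i.succ := by
  refine ⟨fun h hc => (h _ hc).not_gt Fin.castSucc_lt_succ, fun h y hy => ?_⟩
  by_contra hlt
  have h1 : y ≤ i.castSucc := Fin.le_castSucc_iff.2 (not_le.1 hlt)
  have h2 := E.mono (Fin.castSucc_lt_succ (i := i)).le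
  exact h (le_antisymm h2 (hy ▸ E.mono h1))

theorem succ_sub_one (i : Fin n) : i.succ - 1 = i.castSucc := by
  rw [sub_eq_iff_eq_add]
  ext
  rw [Fin.val_add_one_of_lt (Fin.castSucc_lt_last i)]
  simp

theorem flip_castSucc {i : Fin n} (h : E.c i.castSucc = E.c i.succ) :
    ∃ j : Fin n, E.flip i.castSucc = j.succ ∧ E.flip i.succ = j.castSucc := by
  have hlt := E.flip_lt_flip Fin.castSucc_lt_succ h
  obtain ⟨j, hj⟩ := Fin.exists_succ_eq.2 (Fin.ne_zero_of_lt hlt)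
  refine ⟨j, hj.symm, ?_⟩
  rw [← hj] at hlt
  by_contra hne
  have h1 : E.flip i.succ < j.castSucc := lt_of_le_of_ne (Fin.le_castSucc_iff.2 hlt) hne
  -- a point strictly between the two values would be sent strictly between `i` and `i + 1`
  have hc : E.c j.castSucc = E.c i.succ := by
    apply le_antisymm
    · rw [← h, ← E.c_flip i.castSucc, ← hj]
      exact E.mono (Fin.castSucc_lt_succ (i := j)).le
    · rw [← E.c_flip i.succ]
      exact E.mono h1.le
  have h2 := E.flip_lt_flip h1 ((E.c_flip _).trans hc.symm)
  have h3 := E.flip_lt_flip (Fin.castSucc_lt_succ (i := j))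
    (by rw [hc, hj, E.c_flip, h])
  rw [hj, flip_flip] at h3
  rw [flip_flip] at h2
  rw [Fin.lt_def] at h2 h3
  simp only [Fin.val_castSucc, Fin.val_succ] at h2 h3
  omega

/-- The right end of an interval is followed by a left end, and `flip` sends it to the left end of
its own interval. -/
theorem isStart_flip_sub_one {x : Fin (n + 1)} (hx : E.IsStart x) : E.IsStart (E.flip (x - 1)) := by
  have hmax : ∀ y, E.c y = E.c (x - 1) → y ≤ x - 1 := by
    induction x using Fin.cases with
    | zero =>
      intro y _
      rw [show (0 : Fin (n + 1)) - 1 = Fin.last n by rw [sub_eq_iff_eq_add, Fin.last_add_one]]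
      exact Fin.le_last y
    | succ i =>
      intro y hy
      rw [succ_sub_one] at hy ⊢
      rw [Fin.le_castSucc_iff]
      by_contra h
      have h2 := E.mono (Fin.castSucc_lt_succ (i := i)).le
      have := E.mono (not_lt.1 h)
      exact (E.isStart_succ_iff i).1 hx (le_antisymm h2 (hy ▸ this))
  intro y hy
  rw [c_flip] at hy
  have := E.flip_le_flip (hmax (E.flip y) (by rw [c_flip, hy])) (by rw [c_flip, hy])
  rwa [flip_flip] at this

theorem exists_of_not_isStart {x : Fin (n + 1)} (hx : ¬ E.IsStart x) :
    ∃ i : Fin n, x = i.succ ∧ E.c i.castSucc = E.c i.succ := by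
  induction x using Fin.cases with
  | zero => exact absurd E.isStart_zero hx
  | succ i => exact ⟨i, rfl, by rwa [isStart_succ_iff, not_not] at hx⟩

open Classical in
/-- The involution fixing the left end of every interval and reversing the rest of it. -/
noncomputable def innerFlip (x : Fin (n + 1)) : Fin (n + 1) :=
  if E.IsStart x then x else E.flip (x - 1)

theorem innerFlip_of_isStart {x : Fin (n + 1)} (hx : E.IsStart x) : E.innerFlip x = x :=
  if_pos hx

theorem innerFlip_of_not_isStart {x : Fin (n + 1)} (hx : ¬ E.IsStart x) :
    E.innerFlip x = E.flip (x - 1) :=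
  if_neg hx

theorem c_innerFlip (x : Fin (n + 1)) : E.c (E.innerFlip x) = E.c x := by
  by_cases hx : E.IsStart x
  · rw [E.innerFlip_of_isStart hx]
  · rw [E.innerFlip_of_not_isStart hx, c_flip]
    obtain ⟨i, rfl, hi⟩ := E.exists_of_not_isStart hx
    rw [succ_sub_one, hi]

theorem innerFlip_innerFlip (x : Fin (n + 1)) : E.innerFlip (E.innerFlip x) = x := by
  by_cases hx : E.IsStart x
  · rw [E.innerFlip_of_isStart hx, E.innerFlip_of_isStart hx]
  · rw [E.innerFlip_of_not_isStart hx]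
    obtain ⟨i, rfl, hi⟩ := E.exists_of_not_isStart hx
    obtain ⟨j, hj, hj'⟩ := E.flip_castSucc hi
    rw [succ_sub_one, hj]
    have : ¬ E.IsStart j.succ := by
      rw [isStart_succ_iff, not_not, ← hj, ← hj', c_flip, c_flip, hi]
    rw [E.innerFlip_of_not_isStart this, succ_sub_one, ← hj', flip_flip]

theorem rev_sub_one_involutive (y : Fin (n + 1)) : Fin.rev (Fin.rev y - 1) - 1 = y := by
  rw [← Fin.last_sub, ← Fin.last_sub]
  abel

/-- The reflection `y ↦ rev y - 1` of the cyclically ordered points, conjugated by `flip`. -/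
def outerFlip (x : Fin (n + 1)) : Fin (n + 1) := E.flip (E.T x - 1)

theorem outerFlip_outerFlip (x : Fin (n + 1)) : E.outerFlip (E.outerFlip x) = x := by
  simp only [outerFlip, T_eq_rev_flip, flip_flip, rev_sub_one_involutive]

/-- `flip` as a permutation. -/
def flipPerm : Equiv.Perm (Fin (n + 1)) := ⟨E.flip, E.flip, E.flip_flip, E.flip_flip⟩

/-- `innerFlip` as a permutation. -/
noncomputable def innerPerm : Equiv.Perm (Fin (n + 1)) :=
  ⟨E.innerFlip, E.innerFlip, E.innerFlip_innerFlip, E.innerFlip_innerFlip⟩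

/-- `outerFlip` as a permutation. -/
def outerPerm : Equiv.Perm (Fin (n + 1)) :=
  ⟨E.outerFlip, E.outerFlip, E.outerFlip_outerFlip, E.outerFlip_outerFlip⟩

/-- The permutation that follows `T`, but closes up the orbit whenever `T` reaches a left end. -/
noncomputable def loop : Equiv.Perm (Fin (n + 1)) := E.innerPerm * E.outerPerm

theorem loop_apply (x : Fin (n + 1)) : E.loop x = E.innerFlip (E.flip (E.T x - 1)) := rfl

theorem loop_of_not_isStart {x : Fin (n + 1)} (hx : ¬ E.IsStart (E.T x)) : E.loop x = E.T x := by
  rw [loop_apply, ← E.innerFlip_of_not_isStart hx, innerFlip_innerFlip]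

theorem loop_of_isStart {x : Fin (n + 1)} (hx : E.IsStart (E.T x)) :
    E.loop x = E.flip (E.T x - 1) := by
  rw [loop_apply, E.innerFlip_of_isStart (E.isStart_flip_sub_one hx)]

theorem innerFlip_loop (x : Fin (n + 1)) :
    E.innerFlip (E.loop x) = E.loop.symm (E.innerFlip x) := by
  rw [Equiv.eq_symm_apply]
  change E.innerFlip (E.outerFlip (E.innerFlip (E.innerFlip (E.outerFlip x)))) = _
  rw [innerFlip_innerFlip, outerFlip_outerFlip]

theorem exists_isStart_sameCycle :
    ∀ (i : ℕ) (x : Fin (n + 1)), E.IsStart ((E.T ^ i) x) →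
      ∃ y, E.IsStart y ∧ E.loop.SameCycle x y
  | 0, x, h => ⟨x, by simpa using h, Equiv.Perm.SameCycle.refl _ _⟩
  | i + 1, x, h => by
    have hstep : E.loop.SameCycle x (E.loop x) := ⟨1, by simp⟩
    by_cases hx : E.IsStart (E.T x)
    · refine ⟨_, ?_, hstep⟩
      rw [E.loop_of_isStart hx]
      exact E.isStart_flip_sub_one hx
    · rw [pow_succ, Equiv.Perm.mul_apply, ← E.loop_of_not_isStart hx] at h
      obtain ⟨y, hy, hxy⟩ := exists_isStart_sameCycle i _ h
      exact ⟨y, hy, hstep.trans hxy⟩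

/-! ### Counting fixed points -/

theorem add_flip_eq {x : Fin (n + 1)} (hx : E.IsStart x) (y : Fin (n + 1)) (h : E.c y = E.c x) :
    (y : ℕ) + E.flip y = x + E.flip x := by
  induction y using Fin.induction with
  | zero => rw [show x = 0 from le_antisymm (hx 0 h) (Fin.zero_le x)]
  | succ i ih =>
    by_cases hi : E.IsStart i.succ
    · rw [le_antisymm (hx _ h) (hi x h.symm)]
    · rw [isStart_succ_iff, not_not] at hi
      rw [← ih (hi.trans h)]
      obtain ⟨j, hj, hj'⟩ := E.flip_castSucc hi
      rw [hj, hj']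
      simp only [Fin.val_succ, Fin.val_castSucc]
      omega

theorem start_le_flip {x : Fin (n + 1)} (hx : E.IsStart x) : x ≤ E.flip x := hx _ (E.c_flip x)

theorem c_eq_of_le_flip {x y : Fin (n + 1)} (h1 : x ≤ y) (h2 : y ≤ E.flip x) :
    E.c y = E.c x :=
  le_antisymm ((E.mono h2).trans (E.c_flip x).le) (E.mono h1)

/-- The middle of an interval is fixed by `flip` or, if the length is even, by `innerFlip`. -/
theorem exists_middle {x : Fin (n + 1)} (hx : E.IsStart x) :
    ∃ y, E.c y = E.c x ∧ (E.flip y = y ∨ ¬ E.IsStart y ∧ E.innerFlip y = y) := by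
  have hle : (x : ℕ) ≤ E.flip x := E.start_le_flip hx
  have hlt := (E.flip x).isLt
  rcases Nat.even_or_odd' ((x : ℕ) + E.flip x) with ⟨m, hm | hm⟩
  · have hc : E.c ⟨m, by omega⟩ = E.c x :=
      E.c_eq_of_le_flip (Fin.le_def.2 (by simp; omega)) (Fin.le_def.2 (by simp; omega))
    refine ⟨_, hc, Or.inl (Fin.ext ?_)⟩
    have := E.add_flip_eq hx _ hc
    simp only at this ⊢
    omega
  · have hmn : m < n := by omega
    have hc : E.c (Fin.succ ⟨m, hmn⟩) = E.c x :=
      E.c_eq_of_le_flip (Fin.le_def.2 (by simp; omega)) (Fin.le_def.2 (by simp; omega))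
    have hc' : E.c (Fin.castSucc ⟨m, hmn⟩) = E.c x :=
      E.c_eq_of_le_flip (Fin.le_def.2 (by simp; omega)) (Fin.le_def.2 (by simp; omega))
    have hns : ¬ E.IsStart (Fin.succ ⟨m, hmn⟩) := by
      rw [isStart_succ_iff, not_not, hc, hc']
    refine ⟨_, hc, Or.inr ⟨hns, Fin.ext ?_⟩⟩
    rw [E.innerFlip_of_not_isStart hns, succ_sub_one]
    have := E.add_flip_eq hx _ hc'
    simp only [Fin.val_castSucc, Fin.val_succ] at this ⊢
    omega

open Classical in
theorem card_starts_le :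
    2 * (Finset.univ.filter E.IsStart).card ≤
      (Finset.univ.filter fun x => E.innerFlip x = x).card +
        (Finset.univ.filter fun x => E.flip x = x).card := by
  choose! f hfc hf using fun x (hx : E.IsStart x) => E.exists_middle hx
  have hinj : Set.InjOn f (Finset.univ.filter E.IsStart : Finset (Fin (n + 1))) := by
    intro x hx y hy hxy
    simp only [Finset.coe_filter, Finset.mem_univ, true_and, Set.mem_ofPred_eq] at hx hy
    have h : E.c x = E.c y := by rw [← hfc x hx, hxy, hfc y hy]
    exact le_antisymm (hx y h.symm) (hy x h)
  have h1 : (Finset.univ.filter E.IsStart).card ≤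
      (Finset.univ.filter fun x => ¬ E.IsStart x ∧ E.innerFlip x = x).card +
        (Finset.univ.filter fun x => E.flip x = x).card := by
    rw [← Finset.card_image_of_injOn hinj]
    refine (Finset.card_le_card ?_).trans (Finset.card_union_le _ _)
    intro y hy
    simp only [Finset.mem_image, Finset.mem_filter, Finset.mem_univ, true_and] at hy
    obtain ⟨x, hx, rfl⟩ := hy
    simp only [Finset.mem_union, Finset.mem_filter, Finset.mem_univ, true_and]
    exact (hf x hx).symm
  have h2 : (Finset.univ.filter E.IsStart).card +
      (Finset.univ.filter fun x => ¬ E.IsStart x ∧ E.innerFlip x = x).card ≤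
        (Finset.univ.filter fun x => E.innerFlip x = x).card := by
    rw [← Finset.card_union_of_disjoint]
    · apply Finset.card_le_card
      intro x
      simp only [Finset.mem_union, Finset.mem_filter, Finset.mem_univ, true_and]
      rintro (hx | hx)
      · exact E.innerFlip_of_isStart hx
      · exact hx.2
    · rw [Finset.disjoint_left]
      intro x
      simp only [Finset.mem_filter, Finset.mem_univ, true_and]
      exact fun hx hx' => hx'.1 hx
  omega

theorem outerFlip_flip (y : Fin (n + 1)) : E.outerFlip (E.flip y) = E.flip (Fin.rev y - 1) := by
  rw [outerFlip, T_eq_rev_flip, flip_flip]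

theorem two_le_card_fixed_rev_add_outerFlip :
    2 ≤ (Finset.univ.filter fun x : Fin (n + 1) => Fin.rev x = x).card +
      (Finset.univ.filter fun x => E.outerFlip x = x).card := by
  have hlast : E.outerFlip (E.flip (Fin.last n)) = E.flip (Fin.last n) := by
    rw [outerFlip_flip, Fin.rev_last]
    rw [show (0 : Fin (n + 1)) - 1 = Fin.last n by rw [sub_eq_iff_eq_add, Fin.last_add_one]]
  rcases Nat.even_or_odd' n with ⟨m, hm | hm⟩
  · have h1 : 0 < (Finset.univ.filter fun x : Fin (n + 1) => Fin.rev x = x).card :=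
      Finset.card_pos.2 ⟨⟨m, by omega⟩, by
        simp only [Finset.mem_filter, Finset.mem_univ, true_and, Fin.ext_iff, Fin.val_rev]
        omega⟩
    have h2 : 0 < (Finset.univ.filter fun x => E.outerFlip x = x).card :=
      Finset.card_pos.2 ⟨_, by simpa using hlast⟩
    omega
  · have hmid : E.outerFlip (E.flip ⟨m, by omega⟩) = E.flip ⟨m, by omega⟩ := by
      rw [outerFlip_flip]
      congr 1
      rw [sub_eq_iff_eq_add]
      ext
      rw [Fin.val_add_one_of_lt (Fin.lt_def.2 (by simp; omega))]
      simp only [Fin.val_rev]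
      omega
    have : 1 < (Finset.univ.filter fun x => E.outerFlip x = x).card := by
      refine Finset.one_lt_card.2 ⟨_, by simpa using hlast, _, by simpa using hmid, fun h => ?_⟩
      have := congrArg Fin.val (E.flip_injective h)
      simp at this
      omega
    omega

/-- By counting fixed points: `T = rev ∘ flip` has a single cycle, so `rev` and `flip` have at most
two fixed points, and hence `innerFlip` and `outerFlip` have at least two for each left end.  A
cycle of their product `loop` contains at most two, so there are as many cycles as left ends. -/
theorem eq_of_sameCycle_loop {x y : Fin (n + 1)} (hx : E.IsStart x) (hy : E.IsStart y)
    (h : E.loop.SameCycle x y) : x = y := by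
  classical
  have hTmul : Fin.revPerm * E.flipPerm = E.T := by
    ext1 z
    exact (E.T_eq_rev_flip z).symm
  have h1 : (fixedPairs Fin.revPerm E.flipPerm).card ≤ 2 := by
    have := card_fixedPairs_sameCycle_le_two (α := Fin.revPerm) (β := E.flipPerm) (x := 0)
      (by ext1 z; exact Fin.rev_rev z) (by ext1 z; exact E.flip_flip z)
    rw [hTmul] at this
    have hall : ∀ z, E.T.SameCycle 0 z :=
      fun z => E.cycle.2 (Finset.mem_coe.2 (Finset.mem_univ _)) (Finset.mem_coe.2 (Finset.mem_univ _))
    simpa [hall] using this (hall _)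
  let q : Fin (n + 1) → Quotient (Equiv.Perm.SameCycle.setoid E.loop) := Quotient.mk _
  have hq : ∀ a b, q a = q b ↔ E.loop.SameCycle a b := fun a b => Quotient.eq
  let F := fixedPairs E.innerPerm E.outerPerm
  let L := Finset.univ.filter E.IsStart
  have hrep : ∀ z, ∃ l, E.IsStart l ∧ E.loop.SameCycle z l := by
    intro z
    obtain ⟨i, -, hi⟩ := E.exists_pow z 0
    exact E.exists_isStart_sameCycle i z (by rw [hi]; exact E.isStart_zero)
  have h2 : F.card ≤ 2 * (F.image fun p => q p.2).card := by
    apply Finset.card_le_mul_card_image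
    intro a ha
    obtain ⟨z, rfl⟩ := Quotient.exists_rep a
    obtain ⟨l, hl, hzl⟩ := hrep z
    have := card_fixedPairs_sameCycle_le_two (α := E.innerPerm) (β := E.outerPerm) (x := l)
      (by ext1 z; exact E.innerFlip_innerFlip z) (by ext1 z; exact E.outerFlip_outerFlip z)
      (by rw [show E.innerPerm l = l from E.innerFlip_of_isStart hl])
    refine le_trans (Finset.card_le_card ?_) this
    intro p
    simp only [Finset.mem_filter]
    exact fun hp => ⟨hp.1, (hzl.symm.trans ((hq _ _).1 hp.2).symm)⟩
  have h3 : (F.image fun p => q p.2).card ≤ (L.image q).card := by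
    apply Finset.card_le_card
    intro a _
    obtain ⟨z, rfl⟩ := Quotient.exists_rep a
    obtain ⟨l, hl, hzl⟩ := hrep z
    exact Finset.mem_image.2 ⟨l, by simpa [L] using hl, (hq _ _).2 hzl.symm⟩
  have h4 : 2 * L.card ≤ F.card := by
    have e1 := E.card_starts_le
    have e2 := E.two_le_card_fixed_rev_add_outerFlip
    have e3 := card_fixedPairs Fin.revPerm E.flipPerm
    have e4 : F.card = _ := card_fixedPairs E.innerPerm E.outerPerm
    simp only [Fin.revPerm_apply, show ∀ x, E.flipPerm x = E.flip x from fun _ => rfl,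
      show ∀ x, E.innerPerm x = E.innerFlip x from fun _ => rfl,
      show ∀ x, E.outerPerm x = E.outerFlip x from fun _ => rfl] at e3 e4
    change 2 * (Finset.univ.filter E.IsStart).card ≤ _
    omega
  have h5 : (L.image q).card = L.card := le_antisymm Finset.card_image_le (by omega)
  exact Finset.card_image_iff.1 h5 (by simpa [L] using hx) (by simpa [L] using hy) ((hq _ _).2 h)

/-! ### Palindromic special factorizations -/

/-- The orbit of a left end first meets a left end at the beginning of the next interval, and the
letters met on the way form a palindrome, `innerFlip` reversing the loop. -/
theorem exists_first_return {x : Fin (n + 1)} (hx : E.IsStart x) :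
    ∃ t, (E.T ^ (t + 1)) x = E.flip x + 1 ∧ E.IsStart (E.flip x + 1) ∧
      (∀ i < t, ¬ E.IsStart ((E.T ^ (i + 1)) x)) ∧
      ((List.range t).map fun i => E.c ((E.T ^ (i + 1)) x)).Palindrome := by
  classical
  have hex : ∃ t, E.IsStart ((E.T ^ (t + 1)) x) := ⟨n, by rwa [E.T_pow]⟩
  let t := Nat.find hex
  have ht : E.IsStart ((E.T ^ (t + 1)) x) := Nat.find_spec hex
  have hmin : ∀ i < t, ¬ E.IsStart ((E.T ^ (i + 1)) x) := fun i hi => Nat.find_min hex hi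
  have hloop : ∀ i ≤ t, (E.loop ^ i) x = (E.T ^ i) x := by
    intro i
    induction i with
    | zero => simp
    | succ i ih =>
      intro hi
      have h := hmin i hi
      rw [pow_succ', Equiv.Perm.mul_apply] at h ⊢
      rw [ih (by omega), E.loop_of_not_isStart h, pow_succ', Equiv.Perm.mul_apply]
  have hlast : (E.loop ^ (t + 1)) x = E.flip ((E.T ^ (t + 1)) x - 1) := by
    have h := ht
    rw [pow_succ', Equiv.Perm.mul_apply] at h ⊢
    rw [hloop t le_rfl, E.loop_of_isStart h, pow_succ', Equiv.Perm.mul_apply]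
  have hback : (E.loop ^ (t + 1)) x = x := by
    refine (E.eq_of_sameCycle_loop hx ?_ ⟨(t + 1 : ℕ), by rw [zpow_natCast]⟩).symm
    rw [hlast]
    exact E.isStart_flip_sub_one ht
  have hval : (E.T ^ (t + 1)) x = E.flip x + 1 := by
    rw [← sub_eq_iff_eq_add, ← E.flip_flip ((E.T ^ (t + 1)) x - 1), ← hlast, hback]
  refine ⟨t, hval, hval ▸ ht, hmin, palindrome_map_range fun i hi => ?_⟩
  rw [← hloop _ (by omega), ← hloop _ (by omega), ← E.c_innerFlip,
    involution_pow E.innerFlip_loop (i + 1) (t - 1 - i + 1)]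
  rw [E.innerFlip_of_isStart hx, show i + 1 + (t - 1 - i + 1) = t + 1 by omega, hback]

/-- From the left end `x` on, the orbit visits the left ends of the following intervals in
increasing order before it returns to `0`. -/
theorem exists_interleave (l : List A) : ∀ x : Fin (n + 1), E.IsStart x →
    (E.c x :: l).Pairwise (· < ·) →
    (∀ a, a ∈ E.c x :: l ↔ (∃ y, E.c y = a) ∧ E.c x ≤ a) →
    ∃ (π : List (List A)) (N : ℕ), π.length = l.length ∧ (∀ p ∈ π, p.Palindrome) ∧
      interleave (E.c x :: l) π = (List.range (N + 1)).map (fun i => E.c ((E.T ^ i) x)) ∧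
      (E.T ^ (N + 1)) x = 0 ∧ ∀ i < N, (E.T ^ (i + 1)) x ≠ 0 := by
  induction l with
  | nil =>
    intro x hx _ hmem
    refine ⟨[], 0, rfl, by simp, by simp [interleave], ?_, by simp⟩
    have hc : E.c (Fin.last n) = E.c x := by
      simpa using (hmem (E.c (Fin.last n))).2 ⟨⟨_, rfl⟩, E.mono (Fin.le_last x)⟩
    have h := E.flip_le_flip (hx (E.flip (Fin.last n)) (by rw [c_flip, hc])) (by rw [c_flip, hc])
    rw [flip_flip] at h
    rw [zero_add, pow_one, T_eq_rev_flip, le_antisymm (Fin.le_last _) h, Fin.rev_last]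
  | cons b l ih =>
    intro x hx hs hmem
    obtain ⟨t, ht, hstart, hmin, hpal⟩ := E.exists_first_return hx
    have hs' := List.pairwise_cons.1 hs
    have hb : E.c x < b := hs'.1 b (by simp)
    obtain ⟨⟨y, rfl⟩, -⟩ := (hmem b).1 (by simp)
    have hy : E.flip x < y := by
      by_contra h
      exact absurd hb (not_lt.2 ((E.mono (not_lt.1 h)).trans (E.c_flip x).le))
    have hval : ((E.flip x + 1 : Fin (n + 1)) : ℕ) = E.flip x + 1 :=
      Fin.val_add_one_of_lt (hy.trans_le (Fin.le_last y))
    have hgt : E.flip x < E.flip x + 1 := Fin.lt_def.2 (by omega)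
    have hne : E.c (E.flip x + 1) ≠ E.c x := fun hc =>
      absurd (hstart _ ((E.c_flip x).trans hc.symm)) (not_le.2 hgt)
    have hlt : E.c x < E.c (E.flip x + 1) :=
      lt_of_le_of_ne ((E.c_flip x).symm.le.trans (E.mono hgt.le)) hne.symm
    have hcb : E.c (E.flip x + 1) = E.c y := by
      apply le_antisymm
      · exact E.mono (Fin.le_def.2 (by rw [hval]; exact hy))
      · have := (hmem (E.c (E.flip x + 1))).2 ⟨⟨_, rfl⟩, hlt.le⟩
        rw [List.mem_cons, List.mem_cons] at this
        rcases this with h | h | h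
        · exact absurd h hne
        · exact h.ge
        · exact ((List.pairwise_cons.1 hs'.2).1 _ h).le
    obtain ⟨π, N, hlen, hπ, hw, hN, hN'⟩ := ih _ hstart (by rw [hcb]; exact hs'.2) (by
      intro a
      rw [hcb]
      constructor
      · intro ha
        refine ⟨((hmem a).1 (List.mem_cons_of_mem _ ha)).1, ?_⟩
        rcases List.mem_cons.1 ha with rfl | ha
        · exact le_rfl
        · exact ((List.pairwise_cons.1 hs'.2).1 _ ha).le
      · rintro ⟨ha, hle⟩
        rcases List.mem_cons.1 ((hmem a).2 ⟨ha, hb.le.trans hle⟩) with rfl | h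
        · exact absurd hb (not_lt.2 hle)
        · exact h)
    have hadd : ∀ i, (E.T ^ (t + 1 + i)) x = (E.T ^ i) (E.flip x + 1) := by
      intro i
      rw [show t + 1 + i = i + (t + 1) by omega, pow_add, Equiv.Perm.mul_apply, ht]
    refine ⟨((List.range t).map fun i => E.c ((E.T ^ (i + 1)) x)) :: π, t + 1 + N,
      by simp [hlen], ?_, ?_, ?_, ?_⟩
    · intro p hp
      rcases List.mem_cons.1 hp with rfl | hp
      · exact hpal
      · exact hπ p hp
    · rw [hcb] at hw
      have hr : List.range (t + 1 + N + 1) =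
          0 :: ((List.range t).map Nat.succ ++ (List.range (N + 1)).map (t + 1 + ·)) := by
        rw [← List.cons_append, ← List.range_succ_eq_map, ← List.range_add, add_assoc (t + 1)]
      rw [interleave, hw, hr, List.map_cons, List.map_append, List.map_map, List.map_map]
      congr 2
      apply List.map_congr_left
      intro i _
      rw [Function.comp_apply, hadd]
    · rw [add_assoc, hadd, hN]
    · intro i hi
      rcases lt_trichotomy i t with h | rfl | h
      · exact fun h0 => hmin i h (h0 ▸ E.isStart_zero)
      · rw [ht]
        intro h0
        rw [h0] at hlt
        exact absurd hlt (not_lt.2 (E.mono (Fin.zero_le x)))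
      · obtain ⟨j, rfl⟩ : ∃ j, i = t + 1 + j := ⟨i - (t + 1), by omega⟩
        rw [add_assoc, hadd]
        exact hN' j (by omega)

theorem mem_word_iff (a : A) : a ∈ E.word 0 ↔ ∃ y, E.c y = a := by
  simp only [word, List.mem_map, List.mem_range]
  constructor
  · rintro ⟨i, -, rfl⟩
    exact ⟨_, rfl⟩
  · rintro ⟨y, rfl⟩
    obtain ⟨i, hi, rfl⟩ := E.exists_pow 0 y
    exact ⟨i, hi, rfl⟩

theorem exists_isPalindromicSpecialFactorization :
    ∃ π, IsPalindromicSpecialFactorization (E.word 0) π := by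
  have hs := pairwise_letters (E.word 0)
  have hmem : ∀ a, a ∈ letters (E.word 0) ↔ ∃ y, E.c y = a := by
    intro a
    rw [letters, Finset.mem_sort, List.mem_toFinset, mem_word_iff]
  have hmin : ∀ a ∈ letters (E.word 0), E.c 0 ≤ a := by
    intro a ha
    obtain ⟨y, rfl⟩ := (hmem a).1 ha
    exact E.mono (Fin.zero_le y)
  have h0 : E.c 0 ∈ letters (E.word 0) := (hmem _).2 ⟨0, rfl⟩
  obtain ⟨l, hl⟩ : ∃ l, letters (E.word 0) = E.c 0 :: l := by
    rcases h : letters (E.word 0) with _ | ⟨a, l⟩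
    · simp [h] at h0
    · rw [h] at h0 hmin hs
      refine ⟨l, ?_⟩
      rcases List.mem_cons.1 h0 with h | h
      · rw [h]
      · exact absurd ((List.pairwise_cons.1 hs).1 _ h) (not_lt.2 (hmin a (by simp)))
  rw [hl] at hs hmem hmin
  obtain ⟨π, N, hlen, hπ, hw, hN, hN'⟩ := E.exists_interleave l 0 E.isStart_zero hs
    (fun a => ⟨fun ha => ⟨(hmem a).1 ha, hmin a ha⟩, fun ha => (hmem a).2 ha.1⟩)
  -- the first return time to `0` is the number of points
  obtain rfl : N = n := by
    have h1 := Nat.le_of_dvd (by omega) ((E.pow_eq_self_iff 0 (N + 1)).1 hN)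
    have h2 := hN' n
    rw [E.T_pow, Equiv.Perm.one_apply] at h2
    by_contra hne
    exact h2 (by omega) rfl
  exact ⟨π, ⟨by rw [hl]; simp [hlen], by rw [hl, hw, word]⟩, hπ⟩

end SymmetricExchange

end ClusteringWords

theorem theorem3p1 {A : Type*} [LinearOrder A] [Fintype A] (w : List A)
    (hw : ClusteringWords.IsPrimitive w) :
    List.TFAE [
      ClusteringWords.IsPerfectlyClustering w ∧ ClusteringWords.IsLyndon w,
      ClusteringWords.IsProductOfTwoPalindromes w ∧
        ∃ π : List (List A), ClusteringWords.IsPalindromicSpecialFactorization w π,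
      ∃ π : List (List A), ClusteringWords.IsSpecialFactorization w π ∧
        w ~r ClusteringWords.specialReverse w π] := by
  have hne : w ≠ [] := by
    rintro rfl
    exact absurd (hw [] 0 rfl) (by decide)
  tfae_have 1 → 2 := by
    rintro ⟨hc, hl⟩
    obtain ⟨n, E, rfl⟩ := ClusteringWords.exists_exchange_of_isPerfectlyClustering hne hc hl
    exact ⟨E.isProductOfTwoPalindromes_word, E.exists_isPalindromicSpecialFactorization⟩
  tfae_have 2 → 3 := by
    rintro ⟨h, π, hπ⟩
    exact ⟨π, hπ.1, ClusteringWords.exists_isRotated_specialReverse h hπ⟩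
  tfae_have 3 → 1 := by
    rintro ⟨π, hπ, hrot⟩
    obtain ⟨n, E, rfl⟩ := ClusteringWords.exists_exchange_of_isRotated_specialReverse hπ hrot
    exact ⟨E.isPerfectlyClustering_word 0 hw, E.isLyndon_word hw⟩
  tfae_finish
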